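/- Let $d\ge 0$ and $r,s\in\mathbb N$ be integers with $r>s+2+\frac d2$. For an open set $\Omega\subseteq\mathbb R^d$ and $n\in\mathbb N$, let $W_2^n(\Omega)$ be the Sobolev space of functions in $L^2(\Omega)$ whose weak derivatives $\partial^{\alpha}u$, $|\alpha|\le n$, exist and lie in $L^2(\Omega)$, with norm $\|u\|_{W_2^n(\Omega)}=\big(\sum_{|\alpha|\le n}\|\partial^\alpha u\|_{L^2(\Omega)}^2\big)^{1/2}$. Let $k:\mathbb R^d\times\mathbb R^d\to\mathbb R$ be a positive-definite kernel whose reproducing kernel Hilbert space $\mathcal H(k)$ of real-valued functions on $\mathbb R^d$ satisfies $\mathcal H(k)\simeq W_2^r(\mathbb R^d)$; that is, the two are equal as sets of functions (elements of $W_2^r(\mathbb R^d)$ being identified with their continuous representatives, which exist since $r>\frac d2$), and their norms are equivalent. Let $p:\mathbb R^d\to(0,\infty)$ be such that $\log p\in C^{s+1}(\mathbb R^d)$, let $(\mathcal L g)(x)=\Delta g(x)+\nabla g(x)\cdot\nabla\log p(x)$, and let $k_0(x,y)=\mathcal L_x\mathcal L_y k(x,y)$, where $\mathcal L_x$ and $\mathcal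 L_y$ denote $\mathcal L$ applied in the variable $x$ and $y$ respectively. Then $k_0$ is a symmetric positive semi-definite kernel, and its reproducing kernel Hilbert space $\mathcal H=\mathcal H(k_0)$ has the following property: for every open and bounded $D\subset\mathbb R^d$, the space $\mathcal H|_D$ of restrictions to $D$ of elements of $\mathcal H$, with norm $\|v\|_{\mathcal H|_D}=\inf\{\|h\|_{\mathcal H}: h\in\mathcal H,\ h|_D=v\}$, is continuously embedded in $W_2^s(D)$; that is, $\mathcal H|_D\subseteq W_2^s(D)$ and there is a constant $C\ge 0$ such that $\|v\|_{W_2^s(D)}\le C\,\|v\|_{\mathcal H|_D}$ for all $v\in\mathcal H|_D$. -/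

import Mathlib

open MeasureTheory

noncomputable section

/-! ### Sobolev spaces of integer order -/

/-- The partial derivative `∂ f / ∂ x_i` of a function on `ℝ^d`. -/
def partialDeriv {d : ℕ} (i : Fin d) (f : EuclideanSpace ℝ (Fin d) → ℝ) :
    EuclideanSpace ℝ (Fin d) → ℝ :=
  fun x => fderiv ℝ f x (EuclideanSpace.single i (1 : ℝ))

/-- The classical mixed partial derivative `∂^α f = ∂_1^{α_1} ⋯ ∂_d^{α_d} f`. -/
def multiDeriv {d : ℕ} (α : Fin d → ℕ) (f : EuclideanSpace ℝ (Fin d) → ℝ) :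
    EuclideanSpace ℝ (Fin d) → ℝ :=
  (List.finRange d).foldr (fun i g => (partialDeriv i)^[α i] g) f

/-- The finite set of multi-indices `α ∈ ℕ^d` with `|α| ≤ n`. -/
def multiIndices (d n : ℕ) : Finset (Fin d → ℕ) :=
  (Fintype.piFinset fun _ : Fin d => Finset.range (n + 1)).filter (fun α => ∑ i, α i ≤ n)

/-- On the open set `Ω`, the function `g` is a weak derivative `∂^α u`. Only the values of `u` and
`g` on `Ω` matter. -/
def HasWeakDeriv {d : ℕ} (Ω : Set (EuclideanSpace ℝ (Fin d))) (α : Fin d → ℕ)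
    (u g : EuclideanSpace ℝ (Fin d) → ℝ) : Prop :=
  LocallyIntegrableOn u Ω ∧ LocallyIntegrableOn g Ω ∧
    ∀ φ : EuclideanSpace ℝ (Fin d) → ℝ,
      ContDiff ℝ (⊤ : ℕ∞) φ → HasCompactSupport φ → tsupport φ ⊆ Ω →
        ∫ x in Ω, u x * multiDeriv α φ x = (-1 : ℝ) ^ (∑ i, α i) * ∫ x in Ω, g x * φ x

open Classical in
/-- The weak derivative `∂^α u` on `Ω` (unique up to equality almost everywhere on `Ω`), with the
value `0` if there is none. -/
def weakDeriv {d : ℕ} (Ω : Set (EuclideanSpace ℝ (Fin d))) (α : Fin d → ℕ)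
    (u : EuclideanSpace ℝ (Fin d) → ℝ) : EuclideanSpace ℝ (Fin d) → ℝ :=
  if h : ∃ g, HasWeakDeriv Ω α u g then h.choose else 0

/-- `u` (more precisely, its restriction to `Ω`) belongs to `W_2^n(Ω)`: it is square integrable on
`Ω`, and so are its weak derivatives of order at most `n`, which all exist. -/
def MemSobolev {d : ℕ} (n : ℕ) (Ω : Set (EuclideanSpace ℝ (Fin d)))
    (u : EuclideanSpace ℝ (Fin d) → ℝ) : Prop :=
  MemLp u 2 (volume.restrict Ω) ∧
    ∀ α ∈ multiIndices d n, ∃ g, HasWeakDeriv Ω α u g ∧ MemLp g 2 (volume.restrict Ω)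

/-- The Sobolev norm `(∑_{|α| ≤ n} ‖∂^α u‖²_{L²(Ω)})^{1/2}`. -/
def sobolevNorm {d : ℕ} (n : ℕ) (Ω : Set (EuclideanSpace ℝ (Fin d)))
    (u : EuclideanSpace ℝ (Fin d) → ℝ) : ℝ :=
  Real.sqrt (∑ α ∈ multiIndices d n,
    (eLpNorm (weakDeriv Ω α u) 2 (volume.restrict Ω)).toReal ^ 2)

/-! ### Kernels and reproducing kernel Hilbert spaces -/

/-- A symmetric function all of whose kernel matrices at distinct points are positive definite. -/
def IsPosDefKernel {X : Type*} (k : X → X → ℝ) : Prop :=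
  (∀ x y, k x y = k y x) ∧
    ∀ (n : ℕ) (x : Fin n → X), Function.Injective x →
      (Matrix.of fun i j => k (x i) (x j)).PosDef

/-- The reproducing kernel Hilbert space `H` of real-valued functions on `X` has the reproducing
kernel `k`. Mathlib's kernel takes values in the linear maps `ℝ → ℝ`, here identified with reals. -/
def HasKernel {X : Type*} (H : Type*) [NormedAddCommGroup H] [InnerProductSpace ℝ H]
    [CompleteSpace H] [RKHS ℝ H X ℝ] (k : X → X → ℝ) : Prop :=
  ∀ x y, RKHS.kernel H x y 1 = k x y

/-- `H ≃ W_2^r(ℝ^d)` for a Hilbert space `H` of functions on `ℝ^d` and `r > d/2`: the two are equal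
as sets, the elements of `W_2^r(ℝ^d)` being identified with their continuous representatives, and
the two norms are equivalent. -/
def NormEquivSobolev {d : ℕ} (H : Type*) [NormedAddCommGroup H] [InnerProductSpace ℝ H]
    [RKHS ℝ H (EuclideanSpace ℝ (Fin d)) ℝ] (r : ℕ) : Prop :=
  (∀ u : EuclideanSpace ℝ (Fin d) → ℝ,
      (∃ h : H, ⇑h = u) ↔ Continuous u ∧ MemSobolev r Set.univ u) ∧
    (∃ C : ℝ, 0 ≤ C ∧ ∀ h : H, sobolevNorm r Set.univ ⇑h ≤ C * ‖h‖) ∧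
    (∃ C : ℝ, 0 ≤ C ∧ ∀ h : H, ‖h‖ ≤ C * sobolevNorm r Set.univ ⇑h)

/-- The norm `‖v‖_{H|_D} = inf {‖h‖_H : h ∈ H, h|_D = v}` on the space `H|_D` of restrictions to `D`
of the elements of `H`. -/
def restrictionNorm {X : Type*} (H : Type*) [NormedAddCommGroup H] [InnerProductSpace ℝ H]
    [RKHS ℝ H X ℝ] (D : Set X) (v : D → ℝ) : ℝ :=
  sInf {c : ℝ | ∃ h : H, D.domRestrict ⇑h = v ∧ c = ‖h‖}

/-! ### The Stein operator and the Stein kernel -/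

/-- The Langevin Stein operator `(L g)(x) = Δ g(x) + ∇ g(x) ⬝ ∇ log p(x)`. -/
def steinOp {d : ℕ} (p g : EuclideanSpace ℝ (Fin d) → ℝ) (x : EuclideanSpace ℝ (Fin d)) : ℝ :=
  Laplacian.laplacian g x + inner ℝ (gradient g x) (gradient (fun z => Real.log (p z)) x)

/-- The Stein kernel `k₀(x, y) = L_x L_y k(x, y)`. -/
def steinKernel {d : ℕ} (p : EuclideanSpace ℝ (Fin d) → ℝ)
    (k : EuclideanSpace ℝ (Fin d) → EuclideanSpace ℝ (Fin d) → ℝ)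
    (x y : EuclideanSpace ℝ (Fin d)) : ℝ :=
  steinOp p (fun x' => steinOp p (fun y' => k x' y') y) x

end

noncomputable section

/-! Sobolev embedding makes every `f` in `H` of class `C^(s+2)`, so `(L f)(x)` makes sense
pointwise. Derivatives at a point are pointwise limits of difference quotients of evaluations, so by
Banach–Steinhaus `f ↦ (L f)(x)` is continuous on `H`. Let `b x` be its Riesz representer. The
reproducing property gives `k₀(x, y) = ⟪b x, b y⟫` (`steinKernel_eq_inner`), so `k₀` is a Gram
matrix and hence positive semi-definite.

In `H₀` the kernel sections have the same Gram matrix as the `b x` and span a dense subspace.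
Sending the section at `x` to `b x` therefore extends to an isometry into `H`, and every `h` in `H₀`
equals `L f` with `‖f‖ ≤ ‖h‖` (`exists_inner_eq_of_gram_eq`). Such an `L f` is `C^s`. On the bounded
set `D` its derivatives up to order `s` are bounded by a multiple of `‖f‖`, by uniform boundedness
over the points of `D` (`exists_bound_listDeriv`). As `D` has finite volume, this controls the
Sobolev norm, which only sees `h` on `D`, so the infimum over extensions can be taken.

The embedding `contDiff_of_memSobolev` is proved by Fourier transform: weak derivatives become
multiplication by powers of `2πiξ_i`, Cauchy–Schwarz makes `‖ξ‖^n û` integrable for `n ≤ m`, and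
inversion gives a `C^m` function. -/

/-! ### Iterated partial derivatives along a list of directions -/

/-- The iterated partial derivative `∂_{i₁} ⋯ ∂_{iₙ} f` along the list `[i₁, …, iₙ]`. -/
def listDeriv {d : ℕ} (l : List (Fin d)) (f : EuclideanSpace ℝ (Fin d) → ℝ) :
    EuclideanSpace ℝ (Fin d) → ℝ :=
  l.foldr partialDeriv f

/-- The list of directions of the derivative `∂^α`. -/
def multiIndexList {d : ℕ} (α : Fin d → ℕ) : List (Fin d) :=
  (List.finRange d).flatMap fun i => List.replicate (α i) i

theorem listDeriv_append {d : ℕ} (l l' : List (Fin d)) (f : EuclideanSpace ℝ (Fin d) → ℝ) :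
    listDeriv (l ++ l') f = listDeriv l (listDeriv l' f) :=
  List.foldr_append

theorem listDeriv_replicate {d : ℕ} (n : ℕ) (i : Fin d) (f : EuclideanSpace ℝ (Fin d) → ℝ) :
    listDeriv (List.replicate n i) f = (partialDeriv i)^[n] f := by
  induction n with
  | zero => rfl
  | succ n ih =>
    rw [Function.iterate_succ_apply', ← ih]
    rfl

theorem multiDeriv_eq_listDeriv {d : ℕ} (α : Fin d → ℕ) (f : EuclideanSpace ℝ (Fin d) → ℝ) :
    multiDeriv α f = listDeriv (multiIndexList α) f := by
  unfold multiDeriv multiIndexList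
  induction List.finRange d with
  | nil => rfl
  | cons i l ih => rw [List.foldr_cons, ih, List.flatMap_cons, listDeriv_append, listDeriv_replicate]

theorem length_multiIndexList {d : ℕ} (α : Fin d → ℕ) :
    (multiIndexList α).length = ∑ i, α i := by
  simp [multiIndexList, List.length_flatMap, ← List.ofFn_eq_map, List.sum_ofFn]

theorem ContDiff.partialDeriv {d : ℕ} {n : ℕ} {f : EuclideanSpace ℝ (Fin d) → ℝ} (i : Fin d)
    (hf : ContDiff ℝ ((n + 1 : ℕ) : WithTop ℕ∞) f) :
    ContDiff ℝ (n : WithTop ℕ∞) (partialDeriv i f) :=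
  (hf.fderiv_right (by norm_cast)).clm_apply contDiff_const

theorem ContDiff.listDeriv {d : ℕ} {n : ℕ} {f : EuclideanSpace ℝ (Fin d) → ℝ}
    (l : List (Fin d)) (hf : ContDiff ℝ ((n + l.length : ℕ) : WithTop ℕ∞) f) :
    ContDiff ℝ (n : WithTop ℕ∞) (listDeriv l f) := by
  induction l generalizing n with
  | nil => exact hf
  | cons i l ih =>
    refine ContDiff.partialDeriv i (ih ?_)
    rwa [List.length_cons, ← add_assoc, add_right_comm] at hf

theorem continuous_partialDeriv {d : ℕ} {f : EuclideanSpace ℝ (Fin d) → ℝ} (i : Fin d)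
    (hf : ContDiff ℝ 1 f) : Continuous (partialDeriv i f) :=
  (hf.continuous_fderiv one_ne_zero).clm_apply continuous_const

theorem contDiff_listDeriv {d : ℕ} {f : EuclideanSpace ℝ (Fin d) → ℝ}
    (l : List (Fin d)) (hf : ContDiff ℝ (⊤ : ℕ∞) f) : ContDiff ℝ (⊤ : ℕ∞) (listDeriv l f) := by
  rw [contDiff_infty] at hf ⊢
  exact fun n => ContDiff.listDeriv l (hf _)

theorem tsupport_partialDeriv_subset {d : ℕ} (i : Fin d) (f : EuclideanSpace ℝ (Fin d) → ℝ) :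
    tsupport (partialDeriv i f) ⊆ tsupport f := by
  refine (closure_mono fun x hx => ?_).trans (tsupport_fderiv_subset ℝ)
  contrapose! hx
  simp [partialDeriv, Function.notMem_support.mp hx]

theorem tsupport_listDeriv_subset {d : ℕ} (l : List (Fin d))
    (f : EuclideanSpace ℝ (Fin d) → ℝ) : tsupport (listDeriv l f) ⊆ tsupport f := by
  induction l with
  | nil => exact subset_rfl
  | cons i l ih => exact (tsupport_partialDeriv_subset i _).trans ih

theorem hasCompactSupport_listDeriv {d : ℕ} (l : List (Fin d))
    {f : EuclideanSpace ℝ (Fin d) → ℝ} (hf : HasCompactSupport f) :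
    HasCompactSupport (listDeriv l f) :=
  hf.of_isClosed_subset (isClosed_tsupport _) (tsupport_listDeriv_subset l f)

/-! ### Classical derivatives are weak derivatives -/

theorem integral_mul_partialDeriv {d : ℕ} {f φ : EuclideanSpace ℝ (Fin d) → ℝ} (i : Fin d)
    (hf : ContDiff ℝ 1 f) (hφ : ContDiff ℝ 1 φ) (hc : HasCompactSupport φ) :
    ∫ x, f x * partialDeriv i φ x = -∫ x, partialDeriv i f x * φ x := by
  have hc' : HasCompactSupport (partialDeriv i φ) := hasCompactSupport_listDeriv [i] hc
  exact integral_mul_fderiv_eq_neg_fderiv_mul_of_integrable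
    (((continuous_partialDeriv i hf).mul hφ.continuous).integrable_of_hasCompactSupport
      (hc.mul_left))
    ((hf.continuous.mul (continuous_partialDeriv i hφ)).integrable_of_hasCompactSupport
      (hc'.mul_left))
    ((hf.continuous.mul hφ.continuous).integrable_of_hasCompactSupport (hc.mul_left))
    (fun x _ => hf.differentiable one_ne_zero x) (fun x _ => hφ.differentiable one_ne_zero x)

/-- Integration by parts removes the outermost derivative from `φ` first, so the derivatives reach
`f` in reverse order. Keeping the reversed list avoids any appeal to symmetry of mixed partials. -/
theorem integral_mul_listDeriv {d : ℕ} {f φ : EuclideanSpace ℝ (Fin d) → ℝ}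
    (l : List (Fin d)) (hf : ContDiff ℝ (l.length : WithTop ℕ∞) f)
    (hφ : ContDiff ℝ (⊤ : ℕ∞) φ) (hc : HasCompactSupport φ) :
    ∫ x, f x * listDeriv l φ x =
      (-1 : ℝ) ^ l.length * ∫ x, listDeriv l.reverse f x * φ x := by
  induction l generalizing f with
  | nil => simp [listDeriv]
  | cons i l ih =>
    have h1 : ContDiff ℝ 1 f := hf.of_le (by rw [List.length_cons]; norm_cast; omega)
    have h2 : ∫ x, f x * listDeriv (i :: l) φ x =
        -∫ x, partialDeriv i f x * listDeriv l φ x :=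
      integral_mul_partialDeriv i h1
        ((contDiff_listDeriv l hφ).of_le (by exact_mod_cast le_top))
        (hasCompactSupport_listDeriv l hc)
    rw [h2, ih (ContDiff.partialDeriv i (by simpa using hf)), List.reverse_cons, listDeriv_append,
      List.length_cons, pow_succ]
    simp [listDeriv]

theorem setIntegral_mul_eq_integral {d : ℕ} {Ω : Set (EuclideanSpace ℝ (Fin d))}
    (f : EuclideanSpace ℝ (Fin d) → ℝ) {φ : EuclideanSpace ℝ (Fin d) → ℝ}
    (hφ : tsupport φ ⊆ Ω) : ∫ x in Ω, f x * φ x = ∫ x, f x * φ x := by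
  refine setIntegral_eq_integral_of_forall_compl_eq_zero fun x hx => ?_
  rw [image_eq_zero_of_notMem_tsupport fun h => hx (hφ h), mul_zero]

theorem hasWeakDeriv_of_contDiff {d : ℕ} (Ω : Set (EuclideanSpace ℝ (Fin d))) {n : ℕ}
    {f : EuclideanSpace ℝ (Fin d) → ℝ} (hf : ContDiff ℝ (n : WithTop ℕ∞) f) {α : Fin d → ℕ}
    (hα : ∑ i, α i ≤ n) :
    HasWeakDeriv Ω α f (listDeriv (multiIndexList α).reverse f) := by
  have hlen : (multiIndexList α).length ≤ n := by rwa [length_multiIndexList]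
  have hf' : ContDiff ℝ ((multiIndexList α).length : WithTop ℕ∞) f :=
    hf.of_le (by exact_mod_cast hlen)
  have hcont : Continuous (listDeriv (multiIndexList α).reverse f) :=
    (ContDiff.listDeriv (n := 0) (multiIndexList α).reverse (by simpa using hf')).continuous
  refine ⟨hf.continuous.locallyIntegrable.locallyIntegrableOn _,
    hcont.locallyIntegrable.locallyIntegrableOn _, fun φ hφ hc hs => ?_⟩
  rw [multiDeriv_eq_listDeriv, setIntegral_mul_eq_integral _ hs,
    setIntegral_mul_eq_integral _ ((tsupport_listDeriv_subset _ _).trans hs),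
    integral_mul_listDeriv _ hf' hφ hc, length_multiIndexList]

theorem integrable_mul_of_locallyIntegrableOn {d : ℕ} {Ω : Set (EuclideanSpace ℝ (Fin d))}
    {g φ : EuclideanSpace ℝ (Fin d) → ℝ}
    (hg : LocallyIntegrableOn g Ω) (hφ : Continuous φ) (hc : HasCompactSupport φ)
    (hs : tsupport φ ⊆ Ω) : Integrable fun x => g x * φ x := by
  have h1 : IntegrableOn (fun x => g x * φ x) (tsupport φ) :=
    (hg.integrableOn_compact_subset hs hc).mul_continuousOn hφ.continuousOn hc
  refine (integrableOn_iff_integrable_of_support_subset fun x hx => ?_).mp h1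
  exact subset_tsupport φ (Function.mem_support.mpr (right_ne_zero_of_mul hx))

/-- This is the fundamental lemma of the calculus of variations, applied to the difference of the
two candidates. -/
theorem HasWeakDeriv.ae_eq {d : ℕ} {Ω : Set (EuclideanSpace ℝ (Fin d))} (hΩ : IsOpen Ω)
    {α : Fin d → ℕ} {u g g' : EuclideanSpace ℝ (Fin d) → ℝ} (h : HasWeakDeriv Ω α u g)
    (h' : HasWeakDeriv Ω α u g') : g =ᵐ[volume.restrict Ω] g' := by
  have key := hΩ.ae_eq_zero_of_integral_contDiff_smul_eq_zero (μ := volume) (h.2.1.sub h'.2.1)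
    (fun φ hφ hc hs => by
      have e := (h.2.2 φ hφ hc hs).symm.trans (h'.2.2 φ hφ hc hs)
      rw [setIntegral_mul_eq_integral _ hs, setIntegral_mul_eq_integral _ hs] at e
      have e' := mul_left_cancel₀ (pow_ne_zero _ (by norm_num)) e
      simp only [smul_eq_mul, Pi.sub_apply, mul_sub]
      simp only [mul_comm (φ _)]
      rw [integral_sub (integrable_mul_of_locallyIntegrableOn h.2.1 hφ.continuous hc hs)
        (integrable_mul_of_locallyIntegrableOn h'.2.1 hφ.continuous hc hs), e', sub_self])
  rw [Filter.EventuallyEq, ae_restrict_iff' hΩ.measurableSet]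
  filter_upwards [key] with x hx hxΩ
  exact sub_eq_zero.mp (hx hxΩ)

theorem HasWeakDeriv.weakDeriv_ae_eq {d : ℕ} {Ω : Set (EuclideanSpace ℝ (Fin d))}
    (hΩ : IsOpen Ω) {α : Fin d → ℕ} {u g : EuclideanSpace ℝ (Fin d) → ℝ}
    (h : HasWeakDeriv Ω α u g) : weakDeriv Ω α u =ᵐ[volume.restrict Ω] g := by
  have hex : ∃ g, HasWeakDeriv Ω α u g := ⟨g, h⟩
  rw [weakDeriv, dif_pos hex]
  exact hex.choose_spec.ae_eq hΩ h

/-- Since `weakDeriv` is a choice, the predicates selecting it are shown to be equal; the chosen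
functions then coincide. -/
theorem sobolevNorm_congr {d : ℕ} {Ω : Set (EuclideanSpace ℝ (Fin d))} (hΩ : IsOpen Ω) (n : ℕ)
    {u v : EuclideanSpace ℝ (Fin d) → ℝ} (huv : Set.EqOn u v Ω) :
    sobolevNorm n Ω u = sobolevNorm n Ω v := by
  have h : ∀ α, HasWeakDeriv Ω α u = HasWeakDeriv Ω α v := by
    intro α
    have h1 : LocallyIntegrableOn u Ω ↔ LocallyIntegrableOn v Ω := by
      refine ⟨fun h => h.congr ?_, fun h => h.congr ?_⟩
      · exact (ae_restrict_iff' hΩ.measurableSet).mpr (.of_forall huv)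
      · exact (ae_restrict_iff' hΩ.measurableSet).mpr (.of_forall huv.symm)
    have h2 : ∀ φ : EuclideanSpace ℝ (Fin d) → ℝ, ∫ x in Ω, u x * φ x = ∫ x in Ω, v x * φ x :=
      fun φ => setIntegral_congr_fun hΩ.measurableSet fun x hx => by rw [huv hx]
    funext g
    simp only [HasWeakDeriv, h1, h2]
  have hw : ∀ α, weakDeriv Ω α u = weakDeriv Ω α v := fun α => by
    have := h α
    unfold weakDeriv
    generalize HasWeakDeriv Ω α u = P at this
    subst this
    rfl
  simp only [sobolevNorm, hw]

theorem exists_sobolevNorm_le_of_contDiff {d : ℕ} {D : Set (EuclideanSpace ℝ (Fin d))}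
    (hD : IsOpen D) (hb : Bornology.IsBounded D) (n : ℕ) :
    ∃ M : ℝ, 0 ≤ M ∧ ∀ {f : EuclideanSpace ℝ (Fin d) → ℝ}, ContDiff ℝ (n : WithTop ℕ∞) f →
      ∀ {B : ℝ}, 0 ≤ B →
      (∀ α ∈ multiIndices d n, ∀ x ∈ D, |listDeriv (multiIndexList α).reverse f x| ≤ B) →
      MemSobolev n D f ∧ sobolevNorm n D f ≤ M * B := by
  -- The constant is the square root of the number of multi-indices times the volume of `D`.
  refine ⟨Real.sqrt (∑ _α ∈ multiIndices d n,
    ((volume.restrict D Set.univ) ^ ((2 : ENNReal).toReal)⁻¹).toReal ^ 2), Real.sqrt_nonneg _,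
    fun {f} hf {B} hB hbd => ?_⟩
  have hfin : IsFiniteMeasure (volume.restrict D) := ⟨by simpa using hb.measure_lt_top⟩
  have hsum : ∀ α ∈ multiIndices d n, ∑ i, α i ≤ n := fun α hα => (Finset.mem_filter.mp hα).2
  have hae : ∀ α ∈ multiIndices d n,
      ∀ᵐ x ∂(volume.restrict D), ‖listDeriv (multiIndexList α).reverse f x‖ ≤ B := fun α hα =>
    (ae_restrict_iff' hD.measurableSet).mpr (.of_forall (hbd α hα))
  have hmem : ∀ α ∈ multiIndices d n,
      MemLp (listDeriv (multiIndexList α).reverse f) 2 (volume.restrict D) := fun α hα => by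
    have hc : Continuous (listDeriv (multiIndexList α).reverse f) :=
      (ContDiff.listDeriv (n := 0) (multiIndexList α).reverse (hf.of_le (by
        have := hsum α hα
        rw [← length_multiIndexList] at this
        simpa using this))).continuous
    exact MemLp.of_bound hc.aestronglyMeasurable B (hae α hα)
  have h0 : (0 : Fin d → ℕ) ∈ multiIndices d n := by simp [multiIndices]
  refine ⟨⟨?_, fun α hα => ⟨_, hasWeakDeriv_of_contDiff D hf (hsum α hα), hmem α hα⟩⟩, ?_⟩
  · have : multiIndexList (0 : Fin d → ℕ) = [] :=
      List.length_eq_zero_iff.mp (by rw [length_multiIndexList]; simp)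
    simpa [this, listDeriv] using hmem 0 h0
  · rw [sobolevNorm, ← Real.sqrt_sq hB, ← Real.sqrt_mul (Finset.sum_nonneg fun _ _ => sq_nonneg _),
      Finset.sum_mul]
    refine Real.sqrt_le_sqrt (Finset.sum_le_sum fun α hα => ?_)
    rw [← mul_pow]
    refine pow_le_pow_left₀ ENNReal.toReal_nonneg ?_ 2
    rw [eLpNorm_congr_ae ((hasWeakDeriv_of_contDiff D hf (hsum α hα)).weakDeriv_ae_eq hD)]
    have h := eLpNorm_le_of_ae_bound (p := 2) (hae α hα)
    have hne : (volume.restrict D Set.univ) ^ ((2 : ENNReal).toReal)⁻¹ ≠ ⊤ :=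
      ENNReal.rpow_ne_top_of_nonneg (by positivity) (measure_ne_top _ _)
    have h' := ENNReal.toReal_mono (ENNReal.mul_ne_top hne ENNReal.ofReal_ne_top) h
    rwa [ENNReal.toReal_mul, ENNReal.toReal_ofReal hB] at h'

/-! ### Derivatives of a family of functions depending linearly on a Banach space -/

/-- Difference quotients with step `1 / (n + 1)` are continuous functionals converging pointwise; a
pointwise limit of continuous functionals on a Banach space is continuous. -/
theorem exists_clm_partialDeriv {d : ℕ} {F : Type*} [NormedAddCommGroup F] [NormedSpace ℝ F]
    [CompleteSpace F] {Λ : F → EuclideanSpace ℝ (Fin d) → ℝ}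
    (hΛ : ∀ x, ∃ ℓ : F →L[ℝ] ℝ, ∀ f, ℓ f = Λ f x)
    (hd : ∀ f, Differentiable ℝ (Λ f)) (i : Fin d) (x : EuclideanSpace ℝ (Fin d)) :
    ∃ ℓ : F →L[ℝ] ℝ, ∀ f, ℓ f = partialDeriv i (Λ f) x := by
  choose ℓ hℓ using hΛ
  let e : EuclideanSpace ℝ (Fin d) := EuclideanSpace.single i 1
  let c : ℕ → ℝ := fun n => (n : ℝ) + 1
  let q : ℕ → F →L[ℝ] ℝ := fun n => c n • (ℓ (x + (c n)⁻¹ • e) - ℓ x)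
  have hlim : ∀ f, Filter.Tendsto (fun n => q n f) Filter.atTop
      (nhds (partialDeriv i (Λ f) x)) := by
    intro f
    have h := ((hd f x).hasFDerivAt.hasLineDerivAt e).tendsto_slope_zero
    have hc : Filter.Tendsto (fun n => (c n)⁻¹) Filter.atTop (nhdsWithin 0 {0}ᶜ) := by
      refine tendsto_nhdsWithin_iff.mpr ⟨?_, .of_forall fun n => ?_⟩
      · simpa [c] using tendsto_one_div_add_atTop_nhds_zero_nat (𝕜 := ℝ)
      · have : 0 < c n := by positivity
        simpa using this.ne'
    refine (h.comp hc).congr fun n => ?_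
    simp [q, hℓ]
  exact ⟨continuousLinearMapOfTendsto (σ₁₂ := RingHom.id ℝ) q (tendsto_pi_nhds.mpr hlim), fun f => rfl⟩

theorem exists_clm_listDeriv {d : ℕ} {F : Type*} [NormedAddCommGroup F] [NormedSpace ℝ F]
    [CompleteSpace F] {Λ : F → EuclideanSpace ℝ (Fin d) → ℝ}
    (hΛ : ∀ x, ∃ ℓ : F →L[ℝ] ℝ, ∀ f, ℓ f = Λ f x) (l : List (Fin d))
    (hd : ∀ f, ContDiff ℝ (l.length : WithTop ℕ∞) (Λ f)) (x : EuclideanSpace ℝ (Fin d)) :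
    ∃ ℓ : F →L[ℝ] ℝ, ∀ f, ℓ f = listDeriv l (Λ f) x := by
  induction l generalizing x with
  | nil => exact hΛ x
  | cons i l ih =>
    refine exists_clm_partialDeriv (ih fun f => (hd f).of_le (by simp)) (fun f => ?_) i x
    refine ContDiff.differentiable (n := ((1 : ℕ) : WithTop ℕ∞))
      (ContDiff.listDeriv l ?_) (by simp)
    simpa [add_comm] using hd f

/-- Uniform boundedness over the functionals indexed by the points of `D`: for each fixed `f` the
derivative is continuous, hence bounded on the compact closure of `D`. -/
theorem exists_bound_listDeriv {d : ℕ} {F : Type*} [NormedAddCommGroup F] [NormedSpace ℝ F]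
    [CompleteSpace F] {Λ : F → EuclideanSpace ℝ (Fin d) → ℝ}
    (hΛ : ∀ x, ∃ ℓ : F →L[ℝ] ℝ, ∀ f, ℓ f = Λ f x) (l : List (Fin d))
    (hd : ∀ f, ContDiff ℝ (l.length : WithTop ℕ∞) (Λ f))
    {D : Set (EuclideanSpace ℝ (Fin d))} (hb : Bornology.IsBounded D) :
    ∃ C : ℝ, 0 ≤ C ∧ ∀ f, ∀ x ∈ D, |listDeriv l (Λ f) x| ≤ C * ‖f‖ := by
  choose ℓ hℓ using exists_clm_listDeriv hΛ l hd
  obtain ⟨C, hC⟩ := banach_steinhaus (σ₁₂ := RingHom.id ℝ) (g := fun x : D => ℓ x) fun f => by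
    have hc : Continuous (listDeriv l (Λ f)) :=
      (ContDiff.listDeriv (n := 0) l (by simpa using hd f)).continuous
    obtain ⟨C, hC⟩ := hb.isCompact_closure.exists_bound_of_continuousOn hc.continuousOn
    exact ⟨C, fun x => by simpa [hℓ] using hC x (subset_closure x.2)⟩
  -- For empty `D` the constant from Banach–Steinhaus may be negative.
  refine ⟨max C 0, le_max_right _ _, fun f x hx => ?_⟩
  rw [← hℓ x f, ← Real.norm_eq_abs]
  exact (ℓ x).le_of_opNorm_le ((hC ⟨x, hx⟩).trans (le_max_left _ _)) f

/-! ### The Sobolev embedding theorem -/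

theorem partialDeriv_mul {d : ℕ} {f g : EuclideanSpace ℝ (Fin d) → ℝ} (i : Fin d)
    (hf : Differentiable ℝ f) (hg : Differentiable ℝ g) (x : EuclideanSpace ℝ (Fin d)) :
    partialDeriv i (fun y => f y * g y) x = f x * partialDeriv i g x + partialDeriv i f x * g x := by
  simp only [partialDeriv]
  rw [fderiv_fun_mul (hf x) (hg x)]
  simp [mul_comm]

theorem partialDeriv_comp_smul {d : ℕ} {f : EuclideanSpace ℝ (Fin d) → ℝ} (i : Fin d)
    (hf : Differentiable ℝ f) (c : ℝ) (x : EuclideanSpace ℝ (Fin d)) :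
    partialDeriv i (fun y => f (c • y)) x = c * partialDeriv i f (c • x) := by
  have h : HasFDerivAt (fun y : EuclideanSpace ℝ (Fin d) => c • y)
      (c • ContinuousLinearMap.id ℝ _) x := (hasFDerivAt_id x).const_smul c
  have := (hf (c • x)).hasFDerivAt.comp x h
  simp only [partialDeriv]
  rw [show (fun y => f (c • y)) = f ∘ (fun y => c • y) from rfl, this.fderiv]
  simp

/-- A first-order weak derivative between square integrable functions may be tested against all
smooth functions that are square integrable together with their derivative. -/
theorem integral_mul_partialDeriv_of_memLp {d : ℕ} {g g' φ : EuclideanSpace ℝ (Fin d) → ℝ}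
    (i : Fin d) (hg : MemLp g 2) (hg' : MemLp g' 2)
    (h : ∀ φ : EuclideanSpace ℝ (Fin d) → ℝ, ContDiff ℝ (⊤ : ℕ∞) φ → HasCompactSupport φ →
      ∫ x, g x * partialDeriv i φ x = -∫ x, g' x * φ x)
    (hφ : ContDiff ℝ (⊤ : ℕ∞) φ) (hφ2 : MemLp φ 2) (hφ2' : MemLp (partialDeriv i φ) 2) :
    ∫ x, g x * partialDeriv i φ x = -∫ x, g' x * φ x := by
  -- Test with the cutoffs `χ(x / (n + 1)) φ(x)` and let `n → ∞`. The derivative falling on the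
  -- cutoff carries the factor `c n → 0`; dominated convergence handles both sides.
  let χ : ContDiffBump (0 : EuclideanSpace ℝ (Fin d)) := ⟨1, 2, one_pos, one_lt_two⟩
  let c : ℕ → ℝ := fun n => 1 / ((n : ℝ) + 1)
  have hc0 : ∀ n, 0 < c n := fun n => by positivity
  have hc1 : ∀ n, c n ≤ 1 := fun n => by
    rw [div_le_one (by positivity)]; linarith [n.cast_nonneg (α := ℝ)]
  have hc : Filter.Tendsto c Filter.atTop (nhds 0) := tendsto_one_div_add_atTop_nhds_zero_nat
  have hχ : ContDiff ℝ (⊤ : ℕ∞) χ := χ.contDiff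
  have hχd : Differentiable ℝ χ := hχ.differentiable (by simp)
  have hφd : Differentiable ℝ φ := hφ.differentiable (by simp)
  have hχn : ∀ n, ContDiff ℝ (⊤ : ℕ∞) (fun x => χ (c n • x)) := fun n =>
    hχ.comp (contDiff_const_smul _)
  have hχ1 : ContDiff ℝ 1 χ := hχ.of_le (by exact_mod_cast le_top)
  have hφ1 : ContDiff ℝ 1 φ := hφ.of_le (by exact_mod_cast le_top)
  obtain ⟨M, hM⟩ := (hasCompactSupport_listDeriv [i] χ.hasCompactSupport).exists_bound_of_continuous
    (continuous_partialDeriv i hχ1)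
  change ∀ x, ‖partialDeriv i χ x‖ ≤ M at hM
  have hcs : ∀ n, HasCompactSupport (fun x => χ (c n • x) * φ x) := fun n =>
    (χ.hasCompactSupport.comp_smul (hc0 n).ne').mul_right
  have hone : ∀ x, ∀ᶠ n in Filter.atTop, χ (c n • x) = 1 := fun x => by
    have : Filter.Tendsto (fun n => c n • x) Filter.atTop (nhds 0) := by
      simpa using hc.smul_const x
    exact this.eventually χ.eventuallyEq_one
  have hd : ∀ n x, partialDeriv i (fun x => χ (c n • x) * φ x) x =
      χ (c n • x) * partialDeriv i φ x + c n * partialDeriv i χ (c n • x) * φ x := fun n x => by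
    rw [partialDeriv_mul i ((hχn n).differentiable (by simp)) hφd, partialDeriv_comp_smul i hχd]
  have hχle : ∀ y, ‖χ y‖ ≤ 1 := fun y => by
    rw [Real.norm_eq_abs, abs_of_nonneg χ.nonneg]; exact χ.le_one
  have hlim1 : Filter.Tendsto (fun n => ∫ x, g x * partialDeriv i (fun x => χ (c n • x) * φ x) x)
      Filter.atTop (nhds (∫ x, g x * partialDeriv i φ x)) := by
    refine tendsto_integral_of_dominated_convergence
      (fun x => ‖g x * partialDeriv i φ x‖ + M * ‖g x * φ x‖) (fun n => ?_) ?_ (fun n => ?_) ?_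
    · exact hg.1.mul (continuous_partialDeriv i
        (((hχn n).of_le (by exact_mod_cast le_top)).mul hφ1)).aestronglyMeasurable
    · exact (hg.integrable_mul hφ2').norm.add ((hg.integrable_mul hφ2).norm.const_mul M)
    · refine .of_forall fun x => ?_
      rw [hd, mul_add]
      refine (norm_add_le _ _).trans (add_le_add ?_ ?_)
      · rw [mul_left_comm, norm_mul]
        exact mul_le_of_le_one_left (norm_nonneg _) (hχle _)
      · rw [mul_left_comm, norm_mul (c n * _), norm_mul]
        refine mul_le_mul_of_nonneg_right ?_ (norm_nonneg _)
        rw [Real.norm_of_nonneg (hc0 n).le]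
        exact (mul_le_of_le_one_left (norm_nonneg _) (hc1 n)).trans (hM _)
    · refine .of_forall fun x => Filter.Tendsto.const_mul _ ?_
      simp only [hd]
      have e1 : Filter.Tendsto (fun n => χ (c n • x) * partialDeriv i φ x) Filter.atTop
          (nhds (partialDeriv i φ x)) :=
        tendsto_const_nhds.congr' ((hone x).mono fun n hn => by simp [hn])
      have e2 : Filter.Tendsto (fun n => c n * partialDeriv i χ (c n • x) * φ x) Filter.atTop
          (nhds 0) := by
        have : Filter.Tendsto (fun n => c n * partialDeriv i χ (c n • x)) Filter.atTop
            (nhds 0) := by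
          refine hc.zero_mul_isBoundedUnder_le ?_
          exact Filter.isBoundedUnder_of ⟨M, fun n => hM _⟩
        simpa using this.mul_const (φ x)
      simpa using e1.add e2
  have hlim2 : Filter.Tendsto (fun n => -∫ x, g' x * (χ (c n • x) * φ x))
      Filter.atTop (nhds (-∫ x, g' x * φ x)) := by
    refine (tendsto_integral_of_dominated_convergence (fun x => ‖g' x * φ x‖)
      (fun n => ?_) (hg'.integrable_mul hφ2).norm (fun n => ?_) ?_).neg
    · exact hg'.1.mul ((hχn n).continuous.mul hφ.continuous).aestronglyMeasurable
    · refine .of_forall fun x => ?_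
      rw [mul_left_comm, norm_mul]
      exact mul_le_of_le_one_left (norm_nonneg _) (hχle _)
    · refine .of_forall fun x => Filter.Tendsto.const_mul _ ?_
      exact tendsto_const_nhds.congr' ((hone x).mono fun n hn => by simp [hn])
  refine tendsto_nhds_unique hlim1 (hlim2.congr fun n => ?_)
  exact (h _ ((hχn n).mul hφ) (hcs n)).symm

open scoped SchwartzMap FourierTransform LineDeriv ContDiff

/-- Real and imaginary parts of a Schwartz function are admissible real test functions, so the
complex identity follows componentwise. -/
theorem integral_lineDeriv_smul_ofReal {d : ℕ} {g g' : EuclideanSpace ℝ (Fin d) → ℝ}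
    (i : Fin d) (hg : MemLp g 2) (hg' : MemLp g' 2)
    (h : ∀ φ : EuclideanSpace ℝ (Fin d) → ℝ, ContDiff ℝ (⊤ : ℕ∞) φ → HasCompactSupport φ →
      ∫ x, g x * partialDeriv i φ x = -∫ x, g' x * φ x)
    (ψ : 𝓢(EuclideanSpace ℝ (Fin d), ℂ)) :
    ∫ x, (∂_{EuclideanSpace.single i (1 : ℝ)} ψ) x • (g x : ℂ) = -∫ x, ψ x • (g' x : ℂ) := by
  set ψ' := ∂_{EuclideanSpace.single i (1 : ℝ)} ψ with hψ'
  have key : ∀ L : ℂ →L[ℝ] ℝ,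
      ∫ x, L (ψ' x • (g x : ℂ)) = -∫ x, L (ψ x • (g' x : ℂ)) := by
    intro L
    have hL : ∀ (z : ℂ) (t : ℝ), L (z • (t : ℂ)) = t * L z := fun z t => by
      rw [smul_eq_mul, mul_comm, ← Complex.real_smul, map_smul, smul_eq_mul]
    have hsmooth : ContDiff ℝ (⊤ : ℕ∞) (fun x => L (ψ x)) := L.contDiff.comp ψ.smooth'
    have hpd : ∀ x, partialDeriv i (fun x => L (ψ x)) x = L (ψ' x) := fun x => by
      have := (L.hasFDerivAt (x := ψ x)).comp x ψ.differentiableAt.hasFDerivAt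
      simp only [partialDeriv]
      rw [show (fun x => L (ψ x)) = L ∘ ψ from rfl, this.fderiv, hψ',
        SchwartzMap.lineDerivOp_apply_eq_fderiv]
      rfl
    have hmem : ∀ η : 𝓢(EuclideanSpace ℝ (Fin d), ℂ), MemLp (fun x => L (η x)) 2 := fun η =>
      L.comp_memLp' (η.memLp 2)
    have hmem' : MemLp (partialDeriv i (fun x => L (ψ x))) 2 := by
      rw [funext hpd]; exact hmem ψ'
    simp only [hL, ← hpd]
    exact integral_mul_partialDeriv_of_memLp i hg hg' h hsmooth (hmem ψ) hmem'
  have hi1 : Integrable fun x => ψ' x • (g x : ℂ) := (ψ'.memLp 2).integrable_mul hg.ofReal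
  have hi2 : Integrable fun x => ψ x • (g' x : ℂ) := (ψ.memLp 2).integrable_mul hg'.ofReal
  apply Complex.ext
  · have := key Complex.reCLM
    rw [Complex.reCLM.integral_comp_comm hi1, Complex.reCLM.integral_comp_comm hi2] at this
    simpa using this
  · have := key Complex.imCLM
    rw [Complex.imCLM.integral_comp_comm hi1, Complex.imCLM.integral_comp_comm hi2] at this
    simpa using this

/-! ### Fourier transform and weak derivatives in `L²` -/

/-- The Fourier transform of a real-valued square integrable function. -/
def fourierL2 {d : ℕ} {g : EuclideanSpace ℝ (Fin d) → ℝ} (hg : MemLp g 2) :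
    Lp (α := EuclideanSpace ℝ (Fin d)) ℂ 2 :=
  𝓕 ((hg.ofReal (K := ℂ)).toLp : Lp (α := EuclideanSpace ℝ (Fin d)) ℂ 2)

/-- The `L²` transform agrees with the transform of tempered distributions, which is defined by
moving it to the test function. -/
theorem integral_smul_fourierL2 {d : ℕ} {g : EuclideanSpace ℝ (Fin d) → ℝ} (hg : MemLp g 2)
    (ψ : 𝓢(EuclideanSpace ℝ (Fin d), ℂ)) :
    ∫ x, ψ x • fourierL2 hg x = ∫ x, (𝓕 ψ) x • (g x : ℂ) := by
  have h := Lp.fourier_toTemperedDistribution_eq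
    ((hg.ofReal (K := ℂ)).toLp : Lp (α := EuclideanSpace ℝ (Fin d)) ℂ 2)
  have h' := congrArg (fun T : 𝓢'(EuclideanSpace ℝ (Fin d), ℂ) => T ψ) h
  simp only [TemperedDistribution.fourier_apply, Lp.toTemperedDistribution_apply] at h'
  rw [fourierL2, ← h']
  refine integral_congr_ae ?_
  filter_upwards [(hg.ofReal (K := ℂ)).coeFn_toLp] with x hx
  rw [hx]
  rfl

/-- Tested against `ψ`, the factor `2πiξ_i` turns into `-∂_i` on `𝓕 ψ`. As `𝓕 ψ` is Schwartz but
need not have compact support, the weak derivative must first be extended to Schwartz test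
functions. -/
theorem fourierL2_ae_eq {d : ℕ} {g g' : EuclideanSpace ℝ (Fin d) → ℝ}
    (i : Fin d) (hg : MemLp g 2) (hg' : MemLp g' 2)
    (h : ∀ φ : EuclideanSpace ℝ (Fin d) → ℝ, ContDiff ℝ (⊤ : ℕ∞) φ → HasCompactSupport φ →
      ∫ x, g x * partialDeriv i φ x = -∫ x, g' x * φ x) :
    ∀ᵐ ξ, fourierL2 hg' ξ = (2 * Real.pi * Complex.I * (ξ i : ℂ)) * fourierL2 hg ξ := by
  have hloc : LocallyIntegrable (fourierL2 hg) := (Lp.memLp _).locallyIntegrable (by norm_num)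
  have hcont : Continuous fun ξ : EuclideanSpace ℝ (Fin d) =>
      (2 * Real.pi * Complex.I * (ξ i : ℂ)) := by fun_prop
  have hloc' : LocallyIntegrable fun ξ =>
      (2 * Real.pi * Complex.I * (ξ i : ℂ)) * fourierL2 hg ξ := by
    have := hloc.locallyIntegrableOn Set.univ |>.continuousOn_mul hcont.continuousOn
      isOpen_univ.isLocallyClosed
    exact locallyIntegrableOn_univ.mp this
  refine ae_eq_of_integral_contDiff_smul_eq ((Lp.memLp _).locallyIntegrable (by norm_num)) hloc'
    fun φ hφ hc => ?_
  have hc' : HasCompactSupport (Complex.ofRealCLM ∘ φ) := hc.comp_left rfl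
  have hφ' : ContDiff ℝ ∞ (Complex.ofRealCLM ∘ φ) := by fun_prop
  let ψ : 𝓢(EuclideanSpace ℝ (Fin d), ℂ) := hc'.toSchwartzMap hφ'
  have hψ : ∀ x, ψ x = (φ x : ℂ) := fun x => rfl
  have hT : (fun ξ : EuclideanSpace ℝ (Fin d) =>
      (inner ℝ ξ (EuclideanSpace.single i (1 : ℝ)))).HasTemperateGrowth := by fun_prop
  let e : EuclideanSpace ℝ (Fin d) := EuclideanSpace.single i (1 : ℝ)
  have h1 : ∫ ξ, φ ξ • fourierL2 hg' ξ = ∫ ξ, ψ ξ • fourierL2 hg' ξ := by simp [hψ]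
  have h2 : ∫ ξ, φ ξ • ((2 * Real.pi * Complex.I * (ξ i : ℂ)) * fourierL2 hg ξ) =
      ∫ ξ, ((2 * Real.pi * Complex.I) • SchwartzMap.smulLeftCLM ℂ (inner ℝ · e) ψ) ξ •
        fourierL2 hg ξ := by
    congr 1
    funext ξ
    simp only [smul_apply, SchwartzMap.smulLeftCLM_apply_apply hT, hψ, e]
    simp only [Complex.real_smul, smul_eq_mul, EuclideanSpace.inner_single_right]
    simp
    ring
  rw [h1, h2, integral_smul_fourierL2, integral_smul_fourierL2]
  have h3 : 𝓕 ((2 * Real.pi * Complex.I) • SchwartzMap.smulLeftCLM ℂ (inner ℝ · e) ψ) =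
      -∂_{e} (𝓕 ψ) := by
    rw [SchwartzMap.lineDerivOp_fourier_eq, ← FourierTransform.fourier_neg]
    simp
  rw [h3]
  have h4 := integral_lineDeriv_smul_ofReal i hg hg' h (𝓕 ψ)
  simp only [neg_apply, neg_smul, integral_neg]
  rw [h4, neg_neg]

/-! ### Pure derivatives and decay of the Fourier transform -/

theorem multiIndexList_single {d : ℕ} (i : Fin d) (k : ℕ) :
    multiIndexList (Pi.single i k) = List.replicate k i := by
  have h : ∀ l : List (Fin d), l.Nodup →
      (l.flatMap fun j => List.replicate ((Pi.single i k : Fin d → ℕ) j) j) =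
        if i ∈ l then List.replicate k i else [] := by
    intro l hl
    induction l with
    | nil => simp
    | cons j l ih =>
      rw [List.nodup_cons] at hl
      rw [List.flatMap_cons, ih hl.2]
      by_cases hij : i = j
      · subst hij
        simp [hl.1]
      · simp [hij]
  rw [multiIndexList, h _ (List.nodup_finRange d), if_pos (List.mem_finRange i)]

theorem single_mem_multiIndices {d : ℕ} (i : Fin d) {k n : ℕ} (hk : k ≤ n) :
    (Pi.single i k : Fin d → ℕ) ∈ multiIndices d n := by
  simp only [multiIndices, Finset.mem_filter, Fintype.mem_piFinset, Finset.mem_range]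
  refine ⟨fun j => ?_, by simpa using hk⟩
  by_cases hij : j = i
  · subst hij; simpa using Nat.lt_succ_of_le hk
  · simp [Pi.single_eq_of_ne hij]

/-- Using `∂_i φ` as test function for order `k` gives order `k + 1` on `φ`, so consecutive pure
weak derivatives are linked by a first-order one. -/
theorem integral_mul_partialDeriv_of_hasWeakDeriv {d : ℕ}
    {u g g' : EuclideanSpace ℝ (Fin d) → ℝ} {i : Fin d} {k : ℕ}
    (hg : HasWeakDeriv Set.univ (Pi.single i k) u g)
    (hg' : HasWeakDeriv Set.univ (Pi.single i (k + 1)) u g')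
    {φ : EuclideanSpace ℝ (Fin d) → ℝ} (hφ : ContDiff ℝ (⊤ : ℕ∞) φ) (hc : HasCompactSupport φ) :
    ∫ x, g x * partialDeriv i φ x = -∫ x, g' x * φ x := by
  have h1 := hg.2.2 (partialDeriv i φ) (contDiff_listDeriv [i] hφ)
    (hasCompactSupport_listDeriv [i] hc) (Set.subset_univ _)
  have h2 := hg'.2.2 φ hφ hc (Set.subset_univ _)
  have h3 : multiDeriv (Pi.single i k) (partialDeriv i φ) = multiDeriv (Pi.single i (k + 1)) φ := by
    rw [multiDeriv_eq_listDeriv, multiDeriv_eq_listDeriv, multiIndexList_single,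
      multiIndexList_single, List.replicate_succ', listDeriv_append]
    rfl
  rw [h3, h2] at h1
  simp only [Measure.restrict_univ, Finset.sum_pi_single', Finset.mem_univ, if_true, pow_succ]
    at h1
  have h4 := mul_left_cancel₀ (pow_ne_zero k (by norm_num : (-1 : ℝ) ≠ 0))
    ((mul_assoc _ _ _).symm.trans h1)
  rw [← h4, neg_one_mul]

theorem fourierL2_single_ae_eq {d : ℕ} {u : EuclideanSpace ℝ (Fin d) → ℝ} {r : ℕ}
    (hu : MemLp u 2) (hS : MemSobolev r Set.univ u) (i : Fin d) {k : ℕ} (hk : k ≤ r)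
    {g : EuclideanSpace ℝ (Fin d) → ℝ} (hw : HasWeakDeriv Set.univ (Pi.single i k) u g)
    (hg : MemLp g 2) :
    ∀ᵐ ξ, fourierL2 hg ξ = (2 * Real.pi * Complex.I * (ξ i : ℂ)) ^ k * fourierL2 hu ξ := by
  induction k generalizing g with
  | zero =>
    have hw0 : HasWeakDeriv Set.univ (Pi.single i 0) u u := by
      refine ⟨hw.1, hw.1, fun φ _ _ _ => ?_⟩
      rw [multiDeriv_eq_listDeriv, multiIndexList_single]
      simp [listDeriv]
    have hae : g =ᵐ[volume] u := by
      simpa using hw.ae_eq isOpen_univ hw0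
    have : fourierL2 hg = fourierL2 hu := by
      unfold fourierL2
      congr 1
      refine MemLp.toLp_congr _ _ ?_
      filter_upwards [hae] with x hx
      rw [hx]
    simp [this]
  | succ k ih =>
    obtain ⟨g₀, hw₀, hg₀⟩ := hS.2 _ (single_mem_multiIndices i (Nat.le_of_succ_le hk))
    rw [Measure.restrict_univ] at hg₀
    filter_upwards [ih (Nat.le_of_succ_le hk) hw₀ hg₀,
      fourierL2_ae_eq i hg₀ hg fun φ hφ hc =>
        integral_mul_partialDeriv_of_hasWeakDeriv hw₀ hw hφ hc] with ξ h1 h2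
    rw [h2, h1, pow_succ']
    ring

/-- Compare with the `ℓ¹` norm and use the power mean inequality. It lets pure derivatives alone
control the radial weight. Exponent zero would fail for `d = 0`. -/
theorem EuclideanSpace.norm_pow_le_sum {d : ℕ} (x : EuclideanSpace ℝ (Fin d)) (n : ℕ) :
    ‖x‖ ^ (n + 1) ≤ (d : ℝ) ^ n * ∑ i, |x i| ^ (n + 1) := by
  have h1 : ‖x‖ ≤ ∑ i, |x i| := by
    rw [EuclideanSpace.norm_eq, Real.sqrt_le_left (Finset.sum_nonneg fun _ _ => abs_nonneg _)]
    exact Finset.sum_sq_le_sq_sum_of_nonneg fun _ _ => abs_nonneg _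
  rcases Nat.eq_zero_or_pos d with hd | hd
  · subst hd
    have : ‖x‖ = 0 := by rw [Subsingleton.elim x 0, norm_zero]
    simp [this]
  have h2 := pow_sum_div_card_le_sum_pow (s := Finset.univ) (f := fun i => |x i|)
    (fun _ _ => abs_nonneg _) n
  rw [Finset.card_univ, Fintype.card_fin, div_le_iff₀ (by positivity)] at h2
  calc ‖x‖ ^ (n + 1) ≤ (∑ i, |x i|) ^ (n + 1) := by gcongr
    _ ≤ _ := by rw [mul_comm]; exact h2

theorem memLp_one_add_norm_pow_fourierL2 {d : ℕ} {u : EuclideanSpace ℝ (Fin d) → ℝ} {r : ℕ}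
    (hu : MemLp u 2) (hS : MemSobolev (r + 1) Set.univ u) :
    MemLp (fun ξ => (1 + ‖ξ‖) ^ (r + 1) * ‖fourierL2 hu ξ‖) 2 := by
  have hcoord : ∀ i : Fin d, MemLp (fun ξ => |ξ i| ^ (r + 1) * ‖fourierL2 hu ξ‖) 2 := by
    intro i
    obtain ⟨g, hw, hg⟩ := hS.2 _ (single_mem_multiIndices i le_rfl)
    rw [Measure.restrict_univ] at hg
    refine (Lp.memLp (fourierL2 hg)).of_le_mul (c := ((2 * Real.pi) ^ (r + 1))⁻¹) ?_ ?_
    · exact (Continuous.aestronglyMeasurable (by fun_prop)).mul (Lp.aestronglyMeasurable _).norm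
    · filter_upwards [fourierL2_single_ae_eq hu hS i le_rfl hw hg] with ξ hξ
      rw [hξ]
      simp only [norm_mul, norm_pow, mul_pow, Complex.norm_I, Complex.norm_ofNat,
        Complex.norm_real, Real.norm_eq_abs, abs_of_pos Real.pi_pos, mul_one, one_pow, abs_abs,
        abs_norm]
      rw [← mul_pow, ← mul_assoc, ← mul_assoc, inv_mul_cancel₀ (by positivity), one_mul]
  have hsum : MemLp (fun ξ => ‖fourierL2 hu ξ‖ +
      ∑ i : Fin d, |ξ i| ^ (r + 1) * ‖fourierL2 hu ξ‖) 2 :=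
    (Lp.memLp _).norm.add (memLp_finsetSum _ fun i _ => hcoord i)
  -- With `S = ∑ |ξ_i|^(r+1)`, convexity gives `(1 + ‖ξ‖)^(r+1) ≤ 2^r (1 + ‖ξ‖^(r+1)) ≤ 2^r (1 +
  -- d^r)(1 + S)`.
  refine hsum.of_le_mul (c := 2 ^ r * (1 + (d : ℝ) ^ r)) ?_ ?_
  · exact (Continuous.aestronglyMeasurable (by fun_prop)).mul (Lp.aestronglyMeasurable _).norm
  · refine .of_forall fun ξ => ?_
    have hS0 : 0 ≤ ∑ i : Fin d, |ξ i| ^ (r + 1) := Finset.sum_nonneg fun _ _ => by positivity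
    have hd0 : (0 : ℝ) ≤ (d : ℝ) ^ r := by positivity
    rw [← Finset.sum_mul, ← one_add_mul, Real.norm_of_nonneg (by positivity),
      Real.norm_of_nonneg (by positivity), ← mul_assoc]
    refine mul_le_mul_of_nonneg_right ?_ (norm_nonneg _)
    have h1 := add_pow_le zero_le_one (norm_nonneg ξ) (r + 1)
    rw [one_pow, Nat.add_sub_cancel] at h1
    refine h1.trans ?_
    rw [mul_assoc]
    refine mul_le_mul_of_nonneg_left ?_ (by positivity)
    nlinarith [EuclideanSpace.norm_pow_le_sum ξ r]

/-- Cauchy–Schwarz: with `r = m + q + 1`, the weight `(1 + ‖ξ‖)^(-(q+1))` is square integrable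
because `2(q + 1) > d`, and `(1 + ‖ξ‖)^r û` is square integrable. -/
theorem integrable_norm_pow_mul_fourierL2 {d : ℕ} {u : EuclideanSpace ℝ (Fin d) → ℝ} {m r : ℕ}
    (hmr : (m : ℝ) + (d : ℝ) / 2 < r) (hu : MemLp u 2) (hS : MemSobolev r Set.univ u)
    {n : ℕ} (hn : n ≤ m) : Integrable fun ξ => ‖ξ‖ ^ n * ‖fourierL2 hu ξ‖ := by
  have hmr' : m < r := by
    have : (0 : ℝ) ≤ (d : ℝ) / 2 := by positivity
    exact_mod_cast (by linarith : (m : ℝ) < r)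
  obtain ⟨q, rfl⟩ := Nat.exists_eq_add_of_lt hmr'
  have hw : MemLp (fun ξ : EuclideanSpace ℝ (Fin d) => ((1 + ‖ξ‖) ^ (q + 1))⁻¹) 2 := by
    have hcont : Continuous fun ξ : EuclideanSpace ℝ (Fin d) => ((1 + ‖ξ‖) ^ (q + 1))⁻¹ :=
      Continuous.inv₀ (by fun_prop) fun ξ => by positivity
    rw [memLp_two_iff_integrable_sq hcont.aestronglyMeasurable]
    have h := integrable_one_add_norm (E := EuclideanSpace ℝ (Fin d)) (μ := volume)
      (r := 2 * (q + 1)) (by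
        rw [finrank_euclideanSpace_fin]
        push_cast at hmr
        linarith)
    refine h.congr (.of_forall fun ξ => ?_)
    have h0 : 0 < 1 + ‖ξ‖ := by positivity
    simp only
    rw [Real.rpow_neg h0.le, inv_pow, ← pow_mul, mul_comm (q + 1) 2]
    congr 1
    rw [← Real.rpow_natCast]
    push_cast
    rfl
  have h := hw.integrable_mul (memLp_one_add_norm_pow_fourierL2 (r := m + q) hu hS)
  refine h.mono' ?_ (.of_forall fun ξ => ?_)
  · exact (Continuous.aestronglyMeasurable (by fun_prop)).mul (Lp.aestronglyMeasurable _).norm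
  · have h0 : 0 < 1 + ‖ξ‖ := by positivity
    rw [Real.norm_of_nonneg (by positivity)]
    simp only [Pi.mul_apply]
    rw [← mul_assoc]
    refine mul_le_mul_of_nonneg_right ?_ (norm_nonneg _)
    rw [add_assoc m, pow_add _ m, mul_left_comm, inv_mul_cancel₀ (by positivity), mul_one]
    calc ‖ξ‖ ^ n ≤ (1 + ‖ξ‖) ^ n := by gcongr; linarith
      _ ≤ (1 + ‖ξ‖) ^ m := pow_le_pow_right₀ (by linarith [norm_nonneg ξ]) hn

/-- The `L¹` counterpart of `integral_smul_fourierL2`, for the pointwise Fourier integral. -/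
theorem integral_smul_fourier_eq_of_integrable {d : ℕ}
    (ψ : 𝓢(EuclideanSpace ℝ (Fin d), ℂ)) {w : EuclideanSpace ℝ (Fin d) → ℂ} (hw : Integrable w) :
    ∫ x, ψ x • 𝓕 w x = ∫ ξ, 𝓕 ψ ξ • w ξ := by
  symm
  simpa using! VectorFourier.integral_fourierIntegral_smul_eq_flip
    (L := innerₗ (EuclideanSpace ℝ (Fin d))) Real.continuous_fourierChar continuous_inner
    ψ.integrable hw

/-- Sobolev embedding: a continuous function in `W_2^r(ℝ^d)` is of class `C^m` if
`m + d / 2 < r`. -/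
theorem contDiff_of_memSobolev {d : ℕ} {u : EuclideanSpace ℝ (Fin d) → ℝ} {m r : ℕ}
    (hmr : (m : ℝ) + (d : ℝ) / 2 < r) (hcont : Continuous u) (hS : MemSobolev r Set.univ u) :
    ContDiff ℝ (m : WithTop ℕ∞) u := by
  have hu : MemLp u 2 := by simpa using hS.1
  -- After this reflection the forward transform of `w` is the inverse transform of `û`.
  let w : EuclideanSpace ℝ (Fin d) → ℂ := fun ξ => fourierL2 hu (-ξ)
  have hint : ∀ n : ℕ, n ≤ m → Integrable fun ξ => ‖ξ‖ ^ n * ‖w ξ‖ := fun n hn => by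
    simpa [w] using (integrable_norm_pow_mul_fourierL2 hmr hu hS hn).comp_neg
  have hw : Integrable w := by
    have hm : AEStronglyMeasurable w volume :=
      (Lp.aestronglyMeasurable (fourierL2 hu)).comp_measurePreserving
        (Measure.measurePreserving_neg volume)
    exact (integrable_norm_iff hm).mp (by simpa using hint 0 (Nat.zero_le m))
  have hsm : ContDiff ℝ (m : WithTop ℕ∞) (𝓕 w) :=
    Real.contDiff_fourier (N := m) fun n hn => hint n (by exact_mod_cast hn)
  have hcont' : Continuous fun x => (u x : ℂ) := Complex.continuous_ofReal.comp hcont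
  have hae : ∀ᵐ x, 𝓕 w x = (u x : ℂ) := by
    refine ae_eq_of_integral_contDiff_smul_eq hsm.continuous.locallyIntegrable
      hcont'.locallyIntegrable fun φ hφ hc => ?_
    have hc' : HasCompactSupport (Complex.ofRealCLM ∘ φ) := hc.comp_left rfl
    have hφ' : ContDiff ℝ ∞ (Complex.ofRealCLM ∘ φ) := by fun_prop
    let ψ : 𝓢(EuclideanSpace ℝ (Fin d), ℂ) := hc'.toSchwartzMap hφ'
    have hψ : ∀ x, ψ x = (φ x : ℂ) := fun x => rfl
    have h1 : ∫ x, φ x • 𝓕 w x = ∫ x, ψ x • 𝓕 w x := by simp [hψ]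
    have h2 : ∫ x, φ x • (u x : ℂ) = ∫ x, ψ x • (u x : ℂ) := by simp [hψ]
    have h3 : ∫ ξ, 𝓕 ψ ξ • w ξ = ∫ ξ, (𝓕⁻ ψ) ξ • fourierL2 hu ξ := by
      refine Eq.trans ?_ (integral_neg_eq_self (fun ξ => (𝓕⁻ ψ) ξ • fourierL2 hu ξ) volume)
      congr 1
      funext ξ
      rw [SchwartzMap.fourierInv_coe, SchwartzMap.fourier_coe, Real.fourierInv_eq_fourier_neg,
        neg_neg]
    rw [h1, h2, integral_smul_fourier_eq_of_integrable ψ hw, h3, integral_smul_fourierL2,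
      FourierTransform.fourier_fourierInv_eq]
  have heq : 𝓕 w = fun x => (u x : ℂ) :=
    (Continuous.ae_eq_iff_eq volume hsm.continuous hcont').mp hae
  have : u = fun x => Complex.reCLM (𝓕 w x) := by
    funext x
    simp [heq]
  rw [this]
  exact Complex.reCLM.contDiff.comp hsm

/-! ### The Stein operator -/

/-- In coordinates the operator is a combination of iterated partial derivatives, to which the
smoothness and continuity results for `listDeriv` apply. -/
theorem steinOp_eq_sum {d : ℕ} (p : EuclideanSpace ℝ (Fin d) → ℝ)
    {f : EuclideanSpace ℝ (Fin d) → ℝ} (hf : ContDiff ℝ 2 f) (x : EuclideanSpace ℝ (Fin d)) :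
    steinOp p f x = ∑ i, listDeriv [i, i] f x +
      ∑ i, partialDeriv i (fun z => Real.log (p z)) x * listDeriv [i] f x := by
  have hgrad : ∀ (g : EuclideanSpace ℝ (Fin d) → ℝ) (i : Fin d),
      gradient g x i = partialDeriv i g x := fun g i => by
    have h : inner ℝ (gradient g x) (EuclideanSpace.single i (1 : ℝ)) = partialDeriv i g x :=
      InnerProductSpace.toDual_symm_apply
    rw [EuclideanSpace.inner_single_right] at h
    simpa only [one_mul, RCLike.conj_to_real] using h
  rw [steinOp, InnerProductSpace.laplacian_eq_iteratedFDeriv_orthonormalBasis f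
    (EuclideanSpace.basisFun (Fin d) ℝ)]
  congr 1
  · refine Finset.sum_congr rfl fun i _ => ?_
    have hd : DifferentiableAt ℝ (fderiv ℝ f) x :=
      (hf.fderiv_right (m := 1) (by norm_num)).differentiable one_ne_zero x
    have h := hd.hasFDerivAt.clm_apply
      (hasFDerivAt_const (EuclideanSpace.single i (1 : ℝ) : EuclideanSpace ℝ (Fin d)) x)
    rw [iteratedFDeriv_two_apply]
    change _ = fderiv ℝ (fun y => fderiv ℝ f y (EuclideanSpace.single i (1 : ℝ))) x _
    rw [h.fderiv]
    simp
  · rw [PiLp.inner_apply]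
    refine Finset.sum_congr rfl fun i _ => ?_
    rw [hgrad, hgrad]
    rfl

theorem contDiff_steinOp {d s : ℕ} {p f : EuclideanSpace ℝ (Fin d) → ℝ}
    (hp : ContDiff ℝ ((s + 1 : ℕ) : WithTop ℕ∞) (fun x => Real.log (p x)))
    (hf : ContDiff ℝ ((s + 2 : ℕ) : WithTop ℕ∞) f) :
    ContDiff ℝ (s : WithTop ℕ∞) (steinOp p f) := by
  have h2 : ContDiff ℝ 2 f := hf.of_le (by exact_mod_cast Nat.le_add_left 2 s)
  rw [funext (steinOp_eq_sum p h2)]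
  refine (ContDiff.sum fun i _ => ContDiff.listDeriv [i, i] (by simpa using hf)).add
    (ContDiff.sum fun i _ => (ContDiff.partialDeriv i hp).mul (ContDiff.listDeriv [i] ?_))
  exact hf.of_le (by exact_mod_cast Nat.le_succ (s + 1))

theorem exists_clm_steinOp {d : ℕ} (p : EuclideanSpace ℝ (Fin d) → ℝ) {F : Type*}
    [NormedAddCommGroup F] [NormedSpace ℝ F] [CompleteSpace F]
    {Λ : F → EuclideanSpace ℝ (Fin d) → ℝ} (hΛ : ∀ x, ∃ ℓ : F →L[ℝ] ℝ, ∀ f, ℓ f = Λ f x)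
    (hd : ∀ f, ContDiff ℝ 2 (Λ f)) (x : EuclideanSpace ℝ (Fin d)) :
    ∃ ℓ : F →L[ℝ] ℝ, ∀ f, ℓ f = steinOp p (Λ f) x := by
  choose ℓ₂ h₂ using fun i => exists_clm_listDeriv hΛ [i, i] (fun f => by simpa using hd f) x
  choose ℓ₁ h₁ using fun i => exists_clm_listDeriv hΛ [i]
    (fun f => (hd f).of_le (by norm_num)) x
  refine ⟨∑ i, ℓ₂ i + ∑ i, partialDeriv i (fun z => Real.log (p z)) x • ℓ₁ i, fun f => ?_⟩
  rw [steinOp_eq_sum p (hd f)]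
  simp [h₁, h₂]

/-! ### Kernels given by feature maps -/

theorem posSemidef_of_inner {X E : Type*} [NormedAddCommGroup E] [InnerProductSpace ℝ E]
    (b : X → E) : (Matrix.of fun x y => inner ℝ (b x) (b y)).PosSemidef := by
  refine ⟨?_, fun c => ?_⟩
  · ext x y
    simp [real_inner_comm]
  · have h : (c.sum fun i ci => c.sum fun j cj =>
        star ci * (Matrix.of fun x y => inner ℝ (b x) (b y)) i j * cj) =
        inner ℝ (c.sum fun i ci => ci • b i) (c.sum fun i ci => ci • b i) := by
      simp only [Finsupp.sum, sum_inner, inner_sum, real_inner_smul_left, real_inner_smul_right,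
        Matrix.of_apply, star_trivial]
      refine Finset.sum_congr rfl fun i _ => Finset.sum_congr rfl fun j _ => ?_
      rw [real_inner_comm (b i)]
      ring
    rw [h]
    exact real_inner_self_nonneg

/-- Two families with the same Gram matrix: if the first has dense span, every vector of the
ambient space has the same coefficients as some vector of the other space, of no larger norm. -/
theorem exists_inner_eq_of_gram_eq {X E F : Type*} [NormedAddCommGroup E] [InnerProductSpace ℝ E]
    [NormedAddCommGroup F] [InnerProductSpace ℝ F] [CompleteSpace F] {a : X → E} {b : X → F}
    (ha : (Submodule.span ℝ (Set.range a)).topologicalClosure = ⊤)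
    (hab : ∀ x y, inner ℝ (a x) (a y) = inner ℝ (b x) (b y)) (h : E) :
    ∃ f : F, (∀ x, inner ℝ (b x) f = inner ℝ (a x) h) ∧ ‖f‖ ≤ ‖h‖ := by
  let A : (X →₀ ℝ) →ₗ[ℝ] E := Finsupp.linearCombination ℝ a
  let B : (X →₀ ℝ) →ₗ[ℝ] F := Finsupp.linearCombination ℝ b
  have hA : DenseRange A := by
    have : (Submodule.span ℝ (Set.range a) : Set E) = Set.range A := by
      rw [← Finsupp.range_linearCombination]; rfl
    rw [DenseRange, ← this]
    exact Submodule.dense_iff_topologicalClosure_eq_top.mpr ha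
  have hBx : ∀ x c, inner ℝ (b x) (B c) = inner ℝ (a x) (A c) := fun x c => by
    simp only [A, B, Finsupp.linearCombination_apply, Finsupp.sum, inner_sum, inner_smul_right, hab]
  -- Equal Gram matrices give equal norms, so `A c ↦ B c` is well defined and extends by density.
  have hnorm : ∀ c, ‖B c‖ ≤ 1 * ‖A c‖ := fun c => by
    have : inner ℝ (B c) (B c) = inner ℝ (A c) (A c) := by
      conv_lhs => enter [2]; rw [show B c = c.sum fun x t => t • b x from rfl]
      conv_rhs => enter [2]; rw [show A c = c.sum fun x t => t • a x from rfl]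
      simp only [Finsupp.sum, sum_inner, inner_smul_left, hBx]
    rw [one_mul, ← abs_norm (B c), ← abs_norm (A c), ← sq_le_sq, ← real_inner_self_eq_norm_sq,
      ← real_inner_self_eq_norm_sq, this]
  refine ⟨B.extendOfNorm A h, fun x => ?_, ?_⟩
  · refine hA.induction_on (p := fun h => inner ℝ (b x) (B.extendOfNorm A h) = inner ℝ (a x) h) h
      (isClosed_eq (by fun_prop) (by fun_prop)) fun c => ?_
    rw [LinearMap.extendOfNorm_eq hA ⟨1, hnorm⟩, hBx]
  · simpa using LinearMap.norm_extendOfNorm_apply_le hA 1 hnorm h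

/-- Values are scalars, so each section `kerFun H x v` is a multiple of the one with `v = 1`. -/
theorem topologicalClosure_span_kerFun_one {X : Type*} (H : Type*) [NormedAddCommGroup H]
    [InnerProductSpace ℝ H] [CompleteSpace H] [RKHS ℝ H X ℝ] :
    (Submodule.span ℝ (Set.range fun x : X => RKHS.kerFun H x (1 : ℝ))).topologicalClosure = ⊤ := by
  rw [← top_le_iff, ← RKHS.kerFun_dense H]
  refine Submodule.topologicalClosure_mono (Submodule.span_le.mpr ?_)
  rintro _ ⟨x, v, rfl⟩
  have : RKHS.kerFun H x v = v • RKHS.kerFun H x (1 : ℝ) := by rw [← map_smul, smul_eq_mul, mul_one]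
  rw [this]
  exact Submodule.smul_mem _ _ (Submodule.subset_span ⟨x, rfl⟩)

theorem inner_kerFun_one {X : Type*} {H : Type*} [NormedAddCommGroup H]
    [InnerProductSpace ℝ H] [CompleteSpace H] [RKHS ℝ H X ℝ] (x : X) (f : H) :
    inner ℝ (RKHS.kerFun H x (1 : ℝ)) f = f x := by
  rw [RKHS.kerFun_inner]
  simp

theorem kerFun_one_apply {X : Type*} {H : Type*} [NormedAddCommGroup H]
    [InnerProductSpace ℝ H] [CompleteSpace H] [RKHS ℝ H X ℝ] {k : X → X → ℝ} (hk : HasKernel H k)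
    (x y : X) : RKHS.kerFun H y (1 : ℝ) x = k x y := by
  rw [RKHS.kerFun_apply, hk]

/-- The Stein kernel is the Gram matrix of the representers of the functionals
`f ↦ (L f)(x)`. -/
theorem steinKernel_eq_inner {d : ℕ} {k : EuclideanSpace ℝ (Fin d) → EuclideanSpace ℝ (Fin d) → ℝ}
    {H : Type*} [NormedAddCommGroup H] [InnerProductSpace ℝ H] [CompleteSpace H]
    [RKHS ℝ H (EuclideanSpace ℝ (Fin d)) ℝ] (hsymm : ∀ x y, k x y = k y x) (hH : HasKernel H k)
    (p : EuclideanSpace ℝ (Fin d) → ℝ) {b : EuclideanSpace ℝ (Fin d) → H}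
    (hb : ∀ x (f : H), inner ℝ (b x) f = steinOp p f x) (x y : EuclideanSpace ℝ (Fin d)) :
    steinKernel p k x y = inner ℝ (b x) (b y) := by
  -- By symmetry `k(x', ·)` is the kernel section at `x'`. Pairing it with `b y` applies the
  -- operator at `y`, and by the reproducing property also evaluates `b y` at `x'`.
  have h1 : (fun x' => steinOp p (fun y' => k x' y') y) = ⇑(b y) := by
    funext x'
    have : (fun y' => k x' y') = ⇑(RKHS.kerFun H x' (1 : ℝ)) := by
      funext y'
      rw [kerFun_one_apply hH, hsymm]
    rw [this, ← hb, real_inner_comm, inner_kerFun_one]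
  rw [steinKernel, h1, hb]

/-- A bound valid for every extension passes to the infimum after division by `C`; hence the
separate case `C = 0`. -/
theorem le_mul_restrictionNorm {X : Type*} {H : Type*} [NormedAddCommGroup H]
    [InnerProductSpace ℝ H] [RKHS ℝ H X ℝ] (D : Set X) {C t : ℝ} (hC : 0 ≤ C) (h : H)
    (hle : ∀ h' : H, D.domRestrict ⇑h' = D.domRestrict ⇑h → t ≤ C * ‖h'‖) :
    t ≤ C * restrictionNorm H D (D.domRestrict ⇑h) := by
  rcases hC.eq_or_lt with rfl | hC
  · simpa using hle h rfl
  · rw [← div_le_iff₀' hC]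
    refine le_csInf ⟨_, h, rfl, rfl⟩ ?_
    rintro _ ⟨h', hh', rfl⟩
    rw [div_le_iff₀' hC]
    exact hle h' hh'

end

theorem lemma8 {d : ℕ} (r s : ℕ) (hrs : (s : ℝ) + 2 + (d : ℝ) / 2 < (r : ℝ))
    (k : EuclideanSpace ℝ (Fin d) → EuclideanSpace ℝ (Fin d) → ℝ) (hk : IsPosDefKernel k)
    (H : Type*) [NormedAddCommGroup H] [InnerProductSpace ℝ H] [CompleteSpace H]
    [RKHS ℝ H (EuclideanSpace ℝ (Fin d)) ℝ] (hH : HasKernel H k)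
    (hHr : NormEquivSobolev H r)
    (p : EuclideanSpace ℝ (Fin d) → ℝ) (hp : ∀ x, 0 < p x)
    (hlogp : ContDiff ℝ ((s + 1 : ℕ) : WithTop ℕ∞) (fun x => Real.log (p x))) :
    (Matrix.of (steinKernel p k)).PosSemidef ∧
    ∀ (H₀ : Type*) [NormedAddCommGroup H₀] [InnerProductSpace ℝ H₀] [CompleteSpace H₀]
      [RKHS ℝ H₀ (EuclideanSpace ℝ (Fin d)) ℝ], HasKernel H₀ (steinKernel p k) →
      ∀ D : Set (EuclideanSpace ℝ (Fin d)), IsOpen D → Bornology.IsBounded D →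
        ∃ C : ℝ, 0 ≤ C ∧ ∀ h : H₀, MemSobolev s D ⇑h ∧
          sobolevNorm s D ⇑h ≤ C * restrictionNorm H₀ D (D.domRestrict ⇑h) := by
  have hsmooth : ∀ f : H, ContDiff ℝ ((s + 2 : ℕ) : WithTop ℕ∞) ⇑f := fun f => by
    obtain ⟨hc, hS⟩ := (hHr.1 ⇑f).mp ⟨f, rfl⟩
    exact contDiff_of_memSobolev (by push_cast; exact hrs) hc hS
  have heval : ∀ x, ∃ ℓ : H →L[ℝ] ℝ, ∀ f : H, ℓ f = f x := fun x =>
    ⟨innerSL ℝ (RKHS.kerFun H x (1 : ℝ)), fun f => inner_kerFun_one x f⟩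
  have hstein : ∀ x, ∃ ℓ : H →L[ℝ] ℝ, ∀ f : H, ℓ f = steinOp p ⇑f x :=
    exists_clm_steinOp p heval fun f =>
      (hsmooth f).of_le (by exact_mod_cast Nat.le_add_left 2 s)
  choose ℓ hℓ using hstein
  let b : EuclideanSpace ℝ (Fin d) → H := fun x => (InnerProductSpace.toDual ℝ H).symm (ℓ x)
  have hb : ∀ x (f : H), inner ℝ (b x) f = steinOp p ⇑f x := fun x f => by
    rw [← hℓ]
    exact InnerProductSpace.toDual_symm_apply
  have hker : ∀ x y, steinKernel p k x y = inner ℝ (b x) (b y) :=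
    steinKernel_eq_inner hk.1 hH p hb
  refine ⟨?_, fun H₀ _ _ _ _ hH₀ D hD hbD => ?_⟩
  · rw [show steinKernel p k = fun x y => inner ℝ (b x) (b y) from funext₂ hker]
    exact posSemidef_of_inner b
  -- The kernel sections of `H₀` and the vectors `b x` both have Gram matrix `k₀`; equality of
  -- coefficients then reads `h(x) = (L f)(x)`.
  have hrep : ∀ h : H₀, ∃ f : H, ⇑h = steinOp p ⇑f ∧ ‖f‖ ≤ ‖h‖ := fun h => by
    obtain ⟨f, hf, hn⟩ := exists_inner_eq_of_gram_eq (b := b)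
      (topologicalClosure_span_kerFun_one H₀)
      (fun x y => by rw [inner_kerFun_one, kerFun_one_apply hH₀, hker]) h
    refine ⟨f, funext fun x => ?_, hn⟩
    rw [← hb, hf, inner_kerFun_one]
  have hstein_smooth : ∀ f : H, ContDiff ℝ (s : WithTop ℕ∞) (steinOp p ⇑f) := fun f =>
    contDiff_steinOp hlogp (hsmooth f)
  have hbound : ∀ α : Fin d → ℕ, ∃ C : ℝ, 0 ≤ C ∧ (α ∈ multiIndices d s → ∀ f : H, ∀ x ∈ D,
      |listDeriv (multiIndexList α).reverse (steinOp p ⇑f) x| ≤ C * ‖f‖) := fun α => by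
    by_cases hα : α ∈ multiIndices d s
    · have hlen : (multiIndexList α).reverse.length ≤ s := by
        rw [List.length_reverse, length_multiIndexList]
        exact (Finset.mem_filter.mp hα).2
      obtain ⟨C, hC, h⟩ := exists_bound_listDeriv (Λ := fun f : H => steinOp p ⇑f)
        (fun x => ⟨ℓ x, hℓ x⟩) (multiIndexList α).reverse
        (fun f => (hstein_smooth f).of_le (by exact_mod_cast hlen)) hbD
      exact ⟨C, hC, fun _ => h⟩
    · exact ⟨0, le_rfl, fun h => absurd h hα⟩
  choose C hC0 hC using hbound
  -- The sum of the constants serves as one common bound for all derivatives up to order `s`.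
  have hsum0 : 0 ≤ ∑ α ∈ multiIndices d s, C α := Finset.sum_nonneg fun α _ => hC0 α
  obtain ⟨M, hM0, hM⟩ := exists_sobolevNorm_le_of_contDiff hD hbD s
  have hmain : ∀ h : H₀, MemSobolev s D ⇑h ∧
      sobolevNorm s D ⇑h ≤ M * ((∑ α ∈ multiIndices d s, C α) * ‖h‖) := fun h => by
    obtain ⟨f, hf, hn⟩ := hrep h
    rw [hf]
    exact hM (hstein_smooth f) (mul_nonneg hsum0 (norm_nonneg h)) fun α hα x hx =>
      (hC α hα f x hx).trans (mul_le_mul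
        (Finset.single_le_sum (fun β _ => hC0 β) hα) hn (norm_nonneg _) hsum0)
  refine ⟨_, mul_nonneg hM0 hsum0, fun h => ⟨(hmain h).1, ?_⟩⟩
  refine le_mul_restrictionNorm D (mul_nonneg hM0 hsum0) h fun h' hh' => ?_
  -- Every extension `h'` has the same Sobolev norm on `D` as `h`, so the estimate for `h'` bounds
  -- the norm of `h`.
  have heq : Set.EqOn ⇑h ⇑h' D := fun x hx => (congrFun hh' ⟨x, hx⟩).symm
  rw [sobolevNorm_congr hD s heq, mul_assoc]
  exact (hmain h').2
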